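/- **Proposition 7.1.** Let $\mathbb{K}$ be an algebraically closed field of characteristic zero and let $X$ be an irreducible algebraic variety over $\mathbb{K}$, i.e. a reduced irreducible separated scheme of finite type over $\mathbb{K}$. Let $\mathbb{K}[X]$ be the algebra of regular functions on $X$, and by a point of $X$ mean a $\mathbb{K}$-point (equivalently, a closed point). We say that a subset $S\subseteq\mathbb{K}[X]$ *separates points on* $X$ if for any two distinct points $x,y$ of $X$ there is $f\in S$ with $f(x)\neq f(y)$. The following conditions are equivalent. (a) The variety $X$ is quasi-affine, i.e. isomorphic over $\mathbb{K}$ to a locally closed subvariety of an affine space $\mathbb{A}^n_{\mathbb{K}}$ for some integer $n\ge 0$. (b) Regular functions separate points on $X$, i.e. $\mathbb{K}[X]$ separates points on $X$. (c) There are finitely many regular functions that separate points on $X$, i.e. some finite subset of $\mathbb{K}[X]$ separates points on $X$. -/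

import Mathlib

open CategoryTheory AlgebraicGeometry

universe u

namespace VarietyOverField

variable {K : Type u} [Field K] {X : Scheme.{u}}

/-- The points of a variety `π : X ⟶ Spec K` over `K`, i.e. its `K`-rational points. For `K`
algebraically closed and `X` locally of finite type these are the closed points of the scheme `X`
(see `AlgebraicGeometry.pointEquivClosedPoint`). -/
abbrev Point (π : X ⟶ Spec (.of K)) : Type u :=
  { x : Spec (.of K) ⟶ X // x ≫ π = 𝟙 (Spec (.of K)) }

/-- The value `f(x) ∈ K` of a regular function `f ∈ K[X] = Γ(X, ⊤)` at a point `x` of `X`. -/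
noncomputable def value {π : X ⟶ Spec (.of K)} (f : Γ(X, ⊤)) (x : Point π) : K :=
  (Scheme.ΓSpecIso (.of K)).hom (x.1.appTop f)

/-- A set `S` of regular functions on `X` separates points on `X` if for any two distinct points
some function in `S` takes different values at them. -/
def SeparatesPoints (π : X ⟶ Spec (.of K)) (S : Set Γ(X, ⊤)) : Prop :=
  ∀ x y : Point π, x ≠ y → ∃ f ∈ S, value f x ≠ value f y

/-- `X` is quasi-affine if it is isomorphic over `K` to a locally closed subvariety of an affine
space `𝔸ⁿ` over `K` of finite dimension, i.e. admits a (locally closed) immersion into `𝔸ⁿ`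
over `K`. -/
def IsQuasiAffine (π : X ⟶ Spec (.of K)) : Prop :=
  ∃ (n : ℕ) (i : X ⟶ 𝔸(ULift.{u} (Fin n); Spec (.of K))),
    IsImmersion i ∧ i ≫ (𝔸(ULift.{u} (Fin n); Spec (.of K)) ↘ Spec (.of K)) = π

end VarietyOverField

/-! The coordinates of an immersion into affine space separate points. Conversely, if regular
functions separate points, `X.toSpecΓ` is injective on closed points, hence quasi-finite. Zariski's
main theorem then embeds `X` in the normalization of `Spec Γ(X, ⊤)` in `X`, which is affine, so `X`
is a quasi-affine scheme. As `Γ(X, ⊤)` need not be finitely generated, finitely many functions are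
then chosen by clearing denominators on a finite affine cover by basic opens. -/

namespace VarietyOverField

variable {K : Type u} [Field K] {X : Scheme.{u}}

/-- A finite set of regular functions separating points, given by the coordinates of an immersion
into an affine space. -/
lemma IsQuasiAffine.exists_finite_separatesPoints {π : X ⟶ Spec (.of K)} (h : IsQuasiAffine π) :
    ∃ S : Set Γ(X, ⊤), S.Finite ∧ SeparatesPoints π S := by
  obtain ⟨n, i, hi, hiπ⟩ := h
  refine ⟨Set.range fun j ↦ i.appTop (AffineSpace.coord _ j), Set.finite_range _,
    fun x y hxy ↦ ?_⟩
  by_contra! H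
  refine hxy (Subtype.ext ?_)
  rw [← cancel_mono i]
  refine AffineSpace.hom_ext ?_ fun j ↦ ?_
  · simp only [Category.assoc, hiπ, x.2, y.2]
  · have := H _ ⟨j, rfl⟩
    refine (ConcreteCategory.bijective_of_isIso (Scheme.ΓSpecIso (.of K)).hom).1 ?_
    simp only [Scheme.Hom.comp_appTop, CommRingCat.comp_apply]
    exact this

/-- A regular function vanishes at a point if and only if the point lies outside its basic open
set. -/
lemma mem_basicOpen_iff_value_ne_zero {π : X ⟶ Spec (.of K)} (f : Γ(X, ⊤)) (x : Point π) :
    x.1 (IsLocalRing.closedPoint K) ∈ X.basicOpen f ↔ value f x ≠ 0 := by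
  have h : x.1 (IsLocalRing.closedPoint K) ∈ X.basicOpen f ↔
      IsLocalRing.closedPoint K ∈ (Spec (.of K)).basicOpen (x.1.appTop f) := by
    rw [← Scheme.preimage_basicOpen_top]; rfl
  rw [h]
  refine ⟨fun hx h0 ↦ ?_, fun hx ↦ ?_⟩
  · have h0' : x.1.appTop f = 0 :=
      (ConcreteCategory.bijective_of_isIso (Scheme.ΓSpecIso (.of K)).hom).1 (by
        rw [map_zero]; exact h0)
    rw [h0', Scheme.basicOpen_zero] at hx
    exact hx
  · have hu : IsUnit (x.1.appTop f) := by
      have := (isUnit_iff_ne_zero.mpr hx).map (Scheme.ΓSpecIso (.of K)).inv.hom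
      simpa [value] using this
    rw [Scheme.basicOpen_of_isUnit _ hu]
    trivial

/-- Subtracting a constant from a regular function subtracts it from the values. -/
lemma value_sub_const {π : X ⟶ Spec (.of K)} (f : Γ(X, ⊤)) (c : K) (x : Point π) :
    value (f - π.appTop ((Scheme.ΓSpecIso (.of K)).inv c)) x = value f x - c := by
  have h : x.1.appTop (π.appTop ((Scheme.ΓSpecIso (.of K)).inv c)) =
      (Scheme.ΓSpecIso (.of K)).inv c := by
    rw [← CommRingCat.comp_apply, ← Scheme.Hom.comp_appTop, x.2]
    simp
  simp only [value, map_sub, h]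
  simp

/-- If regular functions separate points, then the canonical morphism to the spectrum of the ring
of regular functions separates points. -/
lemma SeparatesPoints.eq_of_toSpecΓ_apply_eq {π : X ⟶ Spec (.of K)}
    (h : SeparatesPoints π Set.univ) (x y : Point π)
    (hxy : X.toSpecΓ (x.1 (IsLocalRing.closedPoint K)) =
      X.toSpecΓ (y.1 (IsLocalRing.closedPoint K))) : x = y := by
  by_contra hne
  obtain ⟨f, -, hf⟩ := h x y hne
  -- `g` vanishes at `x` but not at `y`, and its basic open set is pulled back from `Spec Γ(X, ⊤)`.
  let g := f - π.appTop ((Scheme.ΓSpecIso (.of K)).inv (value f x))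
  have hx : value g x = 0 := by rw [value_sub_const, sub_self]
  have hy : value g y ≠ 0 := by
    rw [value_sub_const]; exact sub_ne_zero.mpr hf.symm
  rw [← mem_basicOpen_iff_value_ne_zero, ← Scheme.toSpecΓ_preimage_basicOpen] at hy
  have hy' : x.1 (IsLocalRing.closedPoint K) ∈ X.toSpecΓ ⁻¹ᵁ PrimeSpectrum.basicOpen g := by
    have hy₂ : (X.toSpecΓ (y.1 (IsLocalRing.closedPoint K)) : PrimeSpectrum Γ(X, ⊤)) ∈
        PrimeSpectrum.basicOpen g := hy
    rwa [← hxy] at hy₂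
  rw [Scheme.toSpecΓ_preimage_basicOpen, mem_basicOpen_iff_value_ne_zero] at hy'
  exact hy' hx

/-- The canonical morphism to the spectrum of the ring of regular functions is a morphism over the
base field. -/
lemma exists_toSpecΓ_comp_eq (π : X ⟶ Spec (.of K)) :
    ∃ q : Spec Γ(X, ⊤) ⟶ Spec (.of K), X.toSpecΓ ≫ q = π :=
  ⟨Spec.map π.appTop ≫ (Spec (.of K)).isoSpec.inv, by
    rw [← Scheme.toSpecΓ_naturality_assoc, ← Scheme.isoSpec_hom, Iso.hom_inv_id,
      Category.comp_id]⟩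

/-- If regular functions separate points of a variety over an algebraically closed field, then the
canonical morphism to the spectrum of the ring of regular functions is quasi-finite. -/
lemma SeparatesPoints.locallyQuasiFinite_toSpecΓ [IsAlgClosed K] {π : X ⟶ Spec (.of K)}
    [LocallyOfFiniteType π] (h : SeparatesPoints π Set.univ) [LocallyOfFiniteType X.toSpecΓ] :
    LocallyQuasiFinite X.toSpecΓ := by
  have : JacobsonSpace X := LocallyOfFiniteType.jacobsonSpace π
  obtain ⟨q, hq⟩ := exists_toSpecΓ_comp_eq π
  rw [← Scheme.Hom.quasiFiniteLocus_eq_top_iff]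
  -- Closed points suffice: the quasi-finite locus is open and `X` is Jacobson.
  have hclosed (x : X) (hx : x ∈ closedPoints X) : x ∈ X.toSpecΓ.quasiFiniteLocus := by
    obtain ⟨p, hp⟩ := (pointEquivClosedPoint π).surjective ⟨x, hx⟩
    replace hp : p.1 (IsLocalRing.closedPoint K) = x := congr($(hp).1)
    -- This composite is a section of the separated morphism `q`.
    have : IsClosedImmersion (p.1 ≫ X.toSpecΓ) :=
      isClosedImmersion_of_comp_eq_id q _ (by rw [Category.assoc, hq, p.2])
    have hy : IsClosed {X.toSpecΓ x} := by
      have hK : IsClosed ({IsLocalRing.closedPoint K} : Set (Spec (.of K))) :=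
        IsLocalRing.isClosed_singleton_closedPoint K
      have := (p.1 ≫ X.toSpecΓ).isClosedEmbedding.isClosedMap _ hK
      have himage : (p.1 ≫ X.toSpecΓ) '' ({IsLocalRing.closedPoint K} : Set (Spec (.of K))) =
          {X.toSpecΓ x} := by
        rw [← hp]
        exact Set.image_singleton
      exact himage ▸ this
    have hfib : X.toSpecΓ ⁻¹' {X.toSpecΓ x} = {x} := by
      have hC := hy.preimage X.toSpecΓ.continuous
      suffices X.toSpecΓ ⁻¹' {X.toSpecΓ x} ∩ closedPoints X = {x} by
        rw [← closure_inter_closedPoints hC, this, IsClosed.closure_eq hx]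
      refine Set.eq_singleton_iff_unique_mem.mpr ⟨⟨rfl, hx⟩, fun z ⟨hz, hz'⟩ ↦ ?_⟩
      obtain ⟨p', hp'⟩ := (pointEquivClosedPoint π).surjective ⟨z, hz'⟩
      replace hp' : p'.1 (IsLocalRing.closedPoint K) = z := congr($(hp').1)
      rw [← hp, ← hp', h.eq_of_toSpecΓ_apply_eq p' p (by rw [hp, hp']; exact hz)]
    rw [Scheme.Hom.mem_quasiFiniteLocus, Scheme.Hom.quasiFiniteAt_iff_isOpen_singleton_asFiber,
      ← (X.toSpecΓ.fiberHomeo (X.toSpecΓ x)).isOpen_image]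
    convert isOpen_univ
    rw [Set.eq_univ_iff_forall]
    rintro ⟨z, hz⟩
    have hzx : z = x := by rw [hfib] at hz; exact hz
    subst hzx
    refine ⟨_, rfl, by simp [Scheme.Hom.asFiber]⟩
  by_contra hne
  have hne' : ((X.toSpecΓ.quasiFiniteLocus : Set X)ᶜ).Nonempty := by
    rw [Set.nonempty_compl]
    exact fun h ↦ hne (TopologicalSpace.Opens.ext h)
  obtain ⟨x, hx, hx'⟩ := nonempty_inter_closedPoints hne'
    X.toSpecΓ.quasiFiniteLocus.isOpen.isClosed_compl.isLocallyClosed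
  exact hx (hclosed x hx')

/-- A variety over an algebraically closed field whose points are separated by regular functions is
a quasi-affine scheme. -/
lemma SeparatesPoints.isQuasiAffine [IsAlgClosed K] {π : X ⟶ Spec (.of K)}
    [LocallyOfFiniteType π] [IsSeparated π] [QuasiCompact π]
    (h : SeparatesPoints π Set.univ) : X.IsQuasiAffine := by
  have : CompactSpace X := QuasiCompact.compactSpace_of_compactSpace π
  obtain ⟨q, hq⟩ := exists_toSpecΓ_comp_eq π
  have : LocallyOfFiniteType (X.toSpecΓ ≫ q) := hq ▸ inferInstance
  have : IsSeparated (X.toSpecΓ ≫ q) := hq ▸ inferInstance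
  have : QuasiCompact (X.toSpecΓ ≫ q) := hq ▸ inferInstance
  have : LocallyOfFiniteType X.toSpecΓ := locallyOfFiniteType_of_comp _ q
  have : IsSeparated X.toSpecΓ := .of_comp _ q
  have : QuasiCompact X.toSpecΓ := .of_comp _ q
  have := h.locallyQuasiFinite_toSpecΓ
  -- The normalization is integral over an affine scheme; by Zariski's main theorem
  -- `toNormalization` is an immersion.
  have : IsAffine X.toSpecΓ.normalization := isAffine_of_isAffineHom X.toSpecΓ.fromNormalization
  exact Scheme.IsQuasiAffine.of_isImmersion X.toSpecΓ.toNormalization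

/-- Clearing denominators: the sections over an affine basic open subset of a scheme of finite type
over an affine base are generated by finitely many global sections and the inverse of the
function defining the subset. -/
lemma exists_finset_forall_mem_of_isAffineOpen_basicOpen (π : X ⟶ Spec (.of K))
    [LocallyOfFiniteType π] [CompactSpace X] [QuasiSeparatedSpace X] (r : Γ(X, ⊤))
    (hr : IsAffineOpen (X.basicOpen r)) :
    ∃ t : Finset Γ(X, ⊤), ∀ R : Subring Γ(X, X.basicOpen r),
      (∀ a, π.appLE ⊤ (X.basicOpen r) le_top a ∈ R) →
      (∀ a ∈ t, X.presheaf.map (homOfLE le_top).op a ∈ R) →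
      (∀ b, b * X.presheaf.map (homOfLE le_top).op r = 1 → b ∈ R) → R = ⊤ := by
  have hft : (π.appLE ⊤ (X.basicOpen r) le_top).hom.FiniteType :=
    π.finiteType_appLE (isAffineOpen_top _) hr le_top
  have := isLocalization_basicOpen_of_qcqs isCompact_univ isQuasiSeparated_univ r
  algebraize [(π.appLE ⊤ (X.basicOpen r) le_top).hom]
  obtain ⟨s, hs⟩ := Algebra.FiniteType.out (R := Γ(Spec (.of K), ⊤)) (A := Γ(X, X.basicOpen r))
  choose m n hmn using fun b : Γ(X, X.basicOpen r) ↦ IsLocalization.Away.surj r b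
  classical
  -- The numerators of the finitely many algebra generators, each of the form `n b / r ^ m b`.
  refine ⟨s.image n, fun R hK ht hinv ↦ top_le_iff.mp fun b _ ↦ ?_⟩
  have hb : b ∈ Algebra.adjoin Γ(Spec (.of K), ⊤) (s : Set Γ(X, X.basicOpen r)) := by
    rw [hs]; trivial
  induction hb using Algebra.adjoin_induction with
  | mem b hb =>
    obtain ⟨c, hc⟩ :=
      (IsLocalization.Away.algebraMap_isUnit (S := Γ(X, X.basicOpen r)) r).exists_left_inv
    have hbn : b = algebraMap _ _ (n b) * c ^ m b := by
      rw [← hmn, mul_assoc, ← mul_pow, mul_comm _ c, hc, one_pow, mul_one]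
    rw [hbn]
    exact mul_mem (ht _ (Finset.mem_image_of_mem n hb)) (pow_mem (hinv c hc) _)
  | algebraMap a => exact hK a
  | add b c _ _ hb hc => exact add_mem (hb trivial) (hc trivial)
  | mul b c _ _ hb hc => exact mul_mem (hb trivial) (hc trivial)

/-- A quasi-affine scheme of finite type over a field admits an immersion into an affine space of
finite dimension. -/
lemma IsQuasiAffine.of_scheme_isQuasiAffine (π : X ⟶ Spec (.of K)) [LocallyOfFiniteType π]
    [X.IsQuasiAffine] : IsQuasiAffine π := by
  have hcov (x : X) : ∃ r : Γ(X, ⊤), IsAffineOpen (X.basicOpen r) ∧ x ∈ X.basicOpen r := by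
    obtain ⟨_, ⟨_, ⟨r, hr, rfl⟩, rfl⟩, hxr, -⟩ :=
      (Scheme.IsQuasiAffine.isBasis_basicOpen X).exists_subset_of_mem_open (Set.mem_univ x)
        isOpen_univ
    exact ⟨r, hr, hxr⟩
  choose r hr hxr using hcov
  obtain ⟨c, hc⟩ := isCompact_univ.elim_finite_subcover (fun x ↦ (X.basicOpen (r x) : Set X))
    (fun x ↦ (X.basicOpen (r x)).isOpen) (fun x _ ↦ Set.mem_iUnion.mpr ⟨x, hxr x⟩)
  choose t ht using fun x ↦ exists_finset_forall_mem_of_isAffineOpen_basicOpen π (r x) (hr x)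
  classical
  let T : Finset Γ(X, ⊤) := c.image r ∪ c.biUnion t
  let v : ULift.{u} (Fin T.card) → Γ(X, ⊤) := fun i ↦ (T.equivFin.symm i.down).1
  have hv (a) (ha : a ∈ T) : ∃ i, v i = a := ⟨⟨T.equivFin ⟨a, ha⟩⟩, by simp [v]⟩
  refine ⟨T.card, AffineSpace.homOfVector π v, ?_, AffineSpace.homOfVector_over _ _⟩
  set f := AffineSpace.homOfVector π v
  let A := 𝔸(ULift.{u} (Fin T.card); Spec (.of K))
  let U (i : ULift.{u} (Fin T.card)) : A.Opens := A.basicOpen (AffineSpace.coord _ i)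
  have hU (i) : f ⁻¹ᵁ U i = X.basicOpen (v i) := by
    rw [Scheme.preimage_basicOpen_top, AffineSpace.homOfVector_appTop_coord]
  choose i hi using fun y : c ↦ hv (r y) (Finset.mem_union_left _ (Finset.mem_image_of_mem r y.2))
  have : MorphismProperty.RespectsRight @IsImmersion @IsOpenImmersion :=
    ⟨fun _ _ _ _ ↦ inferInstance⟩
  -- The opens `U (i y)` need only cover the image of `f`; over each of them `f` is a closed
  -- immersion.
  refine IsZariskiLocalAtTarget.of_range_subset_iSup (fun y : c ↦ U (i y)) ?_ fun y ↦ ?_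
  · rintro _ ⟨x, rfl⟩
    obtain ⟨y, hy, hxy⟩ : ∃ y ∈ c, x ∈ X.basicOpen (r y) := by simpa using hc (Set.mem_univ x)
    simp only [TopologicalSpace.Opens.coe_iSup, Set.mem_iUnion]
    refine ⟨⟨y, hy⟩, ?_⟩
    change x ∈ f ⁻¹ᵁ U (i ⟨y, hy⟩)
    rwa [hU, hi]
  have hUy : f ⁻¹ᵁ U (i y) = X.basicOpen (r y) := by rw [hU, hi]
  have : IsAffine (U (i y)) := (isAffineOpen_top _).basicOpen _
  have : IsAffine (f ⁻¹ᵁ U (i y)) := hUy ▸ hr y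
  suffices IsClosedImmersion (f ∣_ U (i y)) by infer_instance
  refine .of_surjective_of_isAffine _ ?_
  -- A variable `V` allows substituting along `hUy`, which is only a propositional equality.
  have hsurj : ∀ V, V = X.basicOpen (r y) → ∀ e, Function.Surjective (f.appLE (U (i y)) V e) := by
    rintro _ rfl e
    have hconst (ρ) (hρ : f ≫ (A ↘ Spec (.of K)) = ρ) : ρ.appLE ⊤ (X.basicOpen (r y)) le_top =
        (A ↘ Spec (.of K)).appLE ⊤ (U (i y)) le_top ≫ f.appLE (U (i y)) _ e := by
      subst hρ
      exact (Scheme.Hom.appLE_comp_appLE ..).symm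
    have hcoord (k a) (ha : v k = a) : X.presheaf.map (homOfLE le_top).op a =
        f.appLE (U (i y)) (X.basicOpen (r y)) e
          (A.presheaf.map (homOfLE le_top).op (AffineSpace.coord _ k)) := by
      subst ha
      rw [← CommRingCat.comp_apply, Scheme.Hom.map_appLE, Scheme.Hom.appLE,
        CommRingCat.comp_apply]
      congr 1
      exact (AffineSpace.homOfVector_appTop_coord π v k).symm
    refine RingHom.range_eq_top.mp (ht y _ (fun a ↦ ?_) (fun a ha ↦ ?_) fun b hb ↦ ?_)
    · rw [hconst π (AffineSpace.homOfVector_over π v)]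
      exact ⟨_, rfl⟩
    · obtain ⟨k, rfl⟩ := hv a
        (Finset.mem_union_right _ (Finset.mem_biUnion.mpr ⟨y, y.2, ha⟩))
      exact ⟨_, (hcoord k _ rfl).symm⟩
    -- The coordinate mapping to `r y` is invertible on `U (i y)`, and its inverse maps to that of
    -- `r y`.
    · let z : Γ(A, U (i y)) := A.presheaf.map (homOfLE le_top).op (AffineSpace.coord _ (i y))
      have hz : IsUnit z :=
        RingedSpace.isUnit_res_basicOpen A.toRingedSpace (U := ⊤) _
      obtain ⟨w, hw⟩ := hz.exists_right_inv
      refine ⟨w, ?_⟩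
      rw [hcoord (i y) _ (hi y)] at hb
      have hw' := congr(f.appLE (U (i y)) (X.basicOpen (r y)) e $hw)
      rw [map_mul, map_one] at hw'
      exact (left_inv_eq_right_inv hb hw').symm
  rw [← Scheme.Hom.resLE_eq_morphismRestrict, Scheme.Hom.appTop, Scheme.Hom.resLE_app_top]
  simp only [CommRingCat.hom_comp, RingHom.coe_comp]
  exact ((ConcreteCategory.bijective_of_isIso _).2.comp (hsurj _ hUy _)).comp
    (ConcreteCategory.bijective_of_isIso _).2

end VarietyOverField

/-- An irreducible algebraic variety over `K` is a reduced irreducible scheme `X` with a separated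
morphism of finite type `π : X ⟶ Spec K`. -/
theorem proposition7p1 {K : Type u} [Field K] [IsAlgClosed K] [CharZero K]
    (X : Scheme.{u}) (π : X ⟶ Spec (.of K)) [AlgebraicGeometry.IsReduced X] [IrreducibleSpace X]
    [IsSeparated π] [LocallyOfFiniteType π] [QuasiCompact π] :
    List.TFAE
      [VarietyOverField.IsQuasiAffine π,
       VarietyOverField.SeparatesPoints π Set.univ,
       ∃ S : Set Γ(X, ⊤), S.Finite ∧ VarietyOverField.SeparatesPoints π S] := by
  tfae_have 1 → 3 := VarietyOverField.IsQuasiAffine.exists_finite_separatesPoints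
  tfae_have 3 → 2 := fun ⟨S, _, hS⟩ x y hxy ↦
    let ⟨f, _, hf⟩ := hS x y hxy
    ⟨f, Set.mem_univ f, hf⟩
  tfae_have 2 → 1 := fun h ↦
    have := h.isQuasiAffine
    VarietyOverField.IsQuasiAffine.of_scheme_isQuasiAffine π
  tfae_finish
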